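/- Setting. Let $\mathcal X,\mathcal Y,\widehat{\mathcal Y}$ be measurable spaces such that singletons in $\mathcal X$ and $\mathcal Y$ are measurable and $|\mathcal X|=\infty$ or $|\mathcal Y|=\infty$. Fix $\alpha\in(0,1)$ and integers $n,N\ge 1$. A *model* is a measurable function $\mathcal X\to\widehat{\mathcal Y}$. An *algorithm* $\mathcal A$ maps a data set $\mathcal D\in\bigcup_{m\ge 0}(\mathcal X\times\mathcal Y)^m$ and a seed $\xi\in[0,1]$ to a model $\mathcal A(\mathcal D;\xi)$, such that for each $m$ the map $(\mathcal D,\xi,x)\mapsto[\mathcal A(\mathcal D;\xi)](x)$ is measurable on $(\mathcal X\times\mathcal Y)^m\times[0,1]\times\mathcal X$. Let $\psi:\widehat{\mathcal Y}\times\widehat{\mathcal Y}\times\mathcal Y\to[-B,B]$ be measurable and antisymmetric, $\psi(y',y'',y)=-\psi(y'',y',y)$. For a probability distribution $P$ on $\mathcal X\times\mathcal Y$, models $f_0,f_1$ and algorithms $\mathcal A_0,\mathcal A_1$ put $$\Delta_P(f_0,f_1)=\mathbb E_{(X,Y)\sim P}\big[\psi(f_0(X),f_1(X),Y)\big],\qquad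 \Delta_P^{\max}=\sup_{f_0,f_1}\Delta_P(f_0,f_1),$$ $$\Delta_{P,n}(\mathcal A_0,\mathcal A_1)=\mathbb E\big[\Delta_P(\mathcal A_0(\mathcal D_n;\xi),\mathcal A_1(\mathcal D_n;\xi))\big],$$ where $\mathcal D_n$ consists of $n$ i.i.d. points from $P$ and $\xi\sim\mathrm{Unif}[0,1]$ is independent of $\mathcal D_n$. A *black-box test* $\widehat T(\mathcal A_0,\mathcal A_1,\mathcal D_N)\in\{0,1\}$ with $\mathcal D_N\in(\mathcal X\times\mathcal Y)^N$ is given by functions $g^{(1)},g^{(2)},\dots$, a stopping criterion and a function $g$, together with seeds $\zeta^{(1)},\zeta^{(2)},\dots,\zeta$ that are i.i.d. $\mathrm{Unif}[0,1]$ and independent of $\mathcal D_N$, as follows. At round $r=1,2,\dots$ a data set of arbitrary finite size and a seed $$(\mathcal D^{(r)},\xi^{(r)})=g^{(r)}\big(\mathcal D_N,(\mathcal D^{(s)},\widehat f_0^{(s)},\widehat f_1^{(s)},\zeta^{(s)},\xi^{(s)})_{1\le s<r},\zeta^{(r)}\big)$$ are generated and the models $\widehat f_l^{(r)}=\mathcal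 A_l(\mathcal D^{(r)};\xi^{(r)})$, $l=0,1$, are computed. After each round the stopping criterion is evaluated as a function of $\mathcal D_N$ and the records of all rounds so far; let $\widehat r\geq 1$ be the first round after which it holds. The output is $$\widehat T=g\big(\mathcal D_N,(\mathcal D^{(r)},\widehat f_0^{(r)},\widehat f_1^{(r)},\zeta^{(r)},\xi^{(r)})_{1\le r\le\widehat r},\zeta\big)$$ (and $0$ if the procedure never stops). It is required that for all $\mathcal A_0,\mathcal A_1$ the output is a measurable function of $(\mathcal D_N,\zeta^{(1)},\zeta^{(2)},\dots,\zeta)$, and that for all $\mathcal A_0,\mathcal A_1,P$, when $\mathcal D_N$ is drawn i.i.d. from $P$, $\widehat r<\infty$ almost surely. Below, $\mathbb P_P$ refers to $\mathcal D_N$ drawn i.i.d. from $P$ and the seeds of the test. Theorem. Let $\widehat T$ be a black-box test that is valid in the sense that $$\mathbb P_P\big(\widehat T(\mathcal A_0,\mathcal A_1,\mathcal D_N)=1\big)\le\alpha\quad\text{for all }\mathcal A_0,\mathcal A_1,P\text{ with }\Delta_{P,n}(\mathcal A_0,\mathcal A_1)\le 0.$$ Then for all $\mathcal A_0,\mathcal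 A_1$ and all $P$ with $\Delta_{P,n}(\mathcal A_0,\mathcal A_1)>0$ and $\Delta_P^{\max}>\frac{B(\alpha^{-1}-1)}{N}$, $$\mathbb P_P\big(\widehat T(\mathcal A_0,\mathcal A_1,\mathcal D_N)=1\big)\le\left[\alpha\left(1+\frac{\Delta_{P,n}(\mathcal A_0,\mathcal A_1)+\frac{B(\alpha^{-1}-1)}{N}}{\Delta_P^{\max}-\frac{B(\alpha^{-1}-1)}{N}}\right)^{N/n}\right]\wedge 1 .$$ -/

import Mathlib

open MeasureTheory
open scoped unitInterval

noncomputable section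

namespace AlgorithmComparison

/-- A data set with `m` points, i.e. an element of `(X × Y) ^ m`. -/
abbrev DataTuple (X Y : Type*) (m : ℕ) : Type _ := Fin m → X × Y

/-- A data set of arbitrary finite size, i.e. an element of `⋃ m, (X × Y) ^ m`. -/
abbrev Dataset (X Y : Type*) : Type _ := Σ m : ℕ, DataTuple X Y m

/-- Fitted models: measurable functions from the features to the predictions. -/
abbrev Model (X Yhat : Type*) [MeasurableSpace X] [MeasurableSpace Yhat] : Type _ :=
  {f : X → Yhat // Measurable f}

/-- A (possibly randomized) algorithm: it maps a data set of any size and a random seed in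
`[0, 1]` to a fitted model, measurably in (data set, seed, feature) for every size. -/
structure Algorithm (X Y Yhat : Type*)
    [MeasurableSpace X] [MeasurableSpace Y] [MeasurableSpace Yhat] where
  run : (m : ℕ) → DataTuple X Y m → I → Model X Yhat
  measurable_run : ∀ m : ℕ,
    Measurable fun p : DataTuple X Y m × I × X => (run m p.1 p.2.1).1 p.2.2

/-- What is recorded in one round of a black-box comparison test: the generated data set and
algorithm seed, the test's own random seed `ζ`, and the two fitted models. -/
structure Round (X Y Yhat : Type*) [MeasurableSpace X] [MeasurableSpace Yhat] where
  data : Dataset X Y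
  ξ : I
  ζ : I
  f₀ : Model X Yhat
  f₁ : Model X Yhat

/-- The rules of a black-box procedure comparing two algorithms from a data set of size `N`.
Rounds are indexed from `0`, so `query r` is applied when `r` rounds have been completed.
None of the three functions has access to the algorithms other than through the records. -/
structure Procedure (X Y Yhat : Type*) [MeasurableSpace X] [MeasurableSpace Yhat] (N : ℕ) where
  /-- From the data, the records of the first `r` rounds and a fresh seed, generate the data
  set and the algorithm seed of the next round. -/
  query : (r : ℕ) → DataTuple X Y N → (Fin r → Round X Y Yhat) → I → Dataset X Y × I
  /-- The stopping criterion, evaluated after `r` rounds. -/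
  halt : (r : ℕ) → DataTuple X Y N → (Fin r → Round X Y Yhat) → Prop
  /-- The decision after `r` rounds, using one more fresh seed. -/
  decision : (r : ℕ) → DataTuple X Y N → (Fin r → Round X Y Yhat) → I → Bool

/-- The randomness of a run: the data set, the seeds of the successive rounds, the last seed. -/
abbrev Outcome (X Y : Type*) (N : ℕ) : Type _ := DataTuple X Y N × (ℕ → I) × I

/-- The law of the randomness: `N` i.i.d. data points from `P`, and independent i.i.d. seeds,
uniform on `[0, 1]`. -/
def outcomeLaw {X Y : Type*} [MeasurableSpace X] [MeasurableSpace Y]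
    (P : Measure (X × Y)) (N : ℕ) : Measure (Outcome X Y N) :=
  (Measure.pi fun _ : Fin N => P).prod
    ((Measure.infinitePi fun _ : ℕ => (volume : Measure I)).prod (volume : Measure I))

namespace Procedure

variable {X Y Yhat : Type*} [MeasurableSpace X] [MeasurableSpace Y] [MeasurableSpace Yhat]
  {N : ℕ}

/-- The record of the round that follows the records `h`: the query is made and both
algorithms are run on the same data set with the same seed. -/
def nextRound (T : Procedure X Y Yhat N) (A₀ A₁ : Algorithm X Y Yhat) (D : DataTuple X Y N)
    {r : ℕ} (h : Fin r → Round X Y Yhat) (z : I) : Round X Y Yhat where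
  data := (T.query r D h z).1
  ξ := (T.query r D h z).2
  ζ := z
  f₀ := A₀.run (T.query r D h z).1.1 (T.query r D h z).1.2 (T.query r D h z).2
  f₁ := A₁.run (T.query r D h z).1.1 (T.query r D h z).1.2 (T.query r D h z).2

/-- The records of the first `r` rounds. -/
def history (T : Procedure X Y Yhat N) (A₀ A₁ : Algorithm X Y Yhat) (D : DataTuple X Y N)
    (ζs : ℕ → I) : (r : ℕ) → Fin r → Round X Y Yhat
  | 0 => Fin.elim0
  | r + 1 => Fin.snoc (α := fun _ => Round X Y Yhat) (history T A₀ A₁ D ζs r)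
      (T.nextRound A₀ A₁ D (history T A₀ A₁ D ζs r) (ζs r))

/-- The stopping criterion holds after round `r` (at least one round is run). -/
def StopsAt (T : Procedure X Y Yhat N) (A₀ A₁ : Algorithm X Y Yhat) (D : DataTuple X Y N)
    (ζs : ℕ → I) (r : ℕ) : Prop :=
  1 ≤ r ∧ T.halt r D (T.history A₀ A₁ D ζs r)

open Classical in
/-- The output of the run: the decision taken at the first round after which the stopping
criterion holds (and `false` if the run never stops). -/
def output (T : Procedure X Y Yhat N) (A₀ A₁ : Algorithm X Y Yhat) (ω : Outcome X Y N) : Bool :=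
  if h : ∃ r, T.StopsAt A₀ A₁ ω.1 ω.2.1 r then
    T.decision (Nat.find h) ω.1 (T.history A₀ A₁ ω.1 ω.2.1 (Nat.find h)) ω.2.2
  else false

end Procedure

/-- A black-box test for comparing two algorithms: a black-box procedure that uses almost surely
finitely many rounds and whose output depends measurably on the data and the seeds. -/
structure BlackBoxTest (X Y Yhat : Type*)
    [MeasurableSpace X] [MeasurableSpace Y] [MeasurableSpace Yhat] (N : ℕ)
    extends Procedure X Y Yhat N where
  terminates : ∀ (A₀ A₁ : Algorithm X Y Yhat) (P : Measure (X × Y)), IsProbabilityMeasure P →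
    ∀ᵐ ω ∂(outcomeLaw P N), ∃ r, toProcedure.StopsAt A₀ A₁ ω.1 ω.2.1 r
  measurable_output : ∀ A₀ A₁ : Algorithm X Y Yhat,
    Measurable fun ω : Outcome X Y N => toProcedure.output A₀ A₁ ω

section Risk

variable {X Y Yhat : Type*} [MeasurableSpace X] [MeasurableSpace Y] [MeasurableSpace Yhat]

/-- The probability that the test returns `1` when the data are drawn i.i.d. from `P`. -/
def BlackBoxTest.rejectProb {N : ℕ} (T : BlackBoxTest X Y Yhat N) (A₀ A₁ : Algorithm X Y Yhat)
    (P : Measure (X × Y)) : ℝ :=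
  (outcomeLaw P N).real {ω | T.output A₀ A₁ ω = true}

/-- `Δ_P(f₀, f₁) = E_P[ψ(f₀(X), f₁(X), Y)]`. -/
def modelDelta (ψ : Yhat → Yhat → Y → ℝ) (P : Measure (X × Y)) (f₀ f₁ : Model X Yhat) : ℝ :=
  ∫ z, ψ (f₀.1 z.1) (f₁.1 z.1) z.2 ∂P

/-- `Δ_{P,n}(A₀, A₁)`: the expectation of `Δ_P` of the two fitted models, over `n` i.i.d.
training points from `P` and a common independent uniform seed. -/
def algDelta (ψ : Yhat → Yhat → Y → ℝ) (P : Measure (X × Y)) (n : ℕ)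
    (A₀ A₁ : Algorithm X Y Yhat) : ℝ :=
  ∫ ω : DataTuple X Y n × I, modelDelta ψ P (A₀.run n ω.1 ω.2) (A₁.run n ω.1 ω.2)
    ∂((Measure.pi fun _ : Fin n => P).prod (volume : Measure I))

/-- `Δ_P^max`: the supremum of `Δ_P(f₀, f₁)` over all pairs of models. -/
def deltaMax (ψ : Yhat → Yhat → Y → ℝ) (P : Measure (X × Y)) : ℝ :=
  ⨆ f : Model X Yhat × Model X Yhat, modelDelta ψ P f.1 f.2

/-- Assumption-free validity at level `α`. -/
def BlackBoxTest.IsValid {N : ℕ} (T : BlackBoxTest X Y Yhat N) (ψ : Yhat → Yhat → Y → ℝ)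
    (n : ℕ) (α : ℝ) : Prop :=
  ∀ (A₀ A₁ : Algorithm X Y Yhat) (P : Measure (X × Y)), IsProbabilityMeasure P →
    algDelta ψ P n A₀ A₁ ≤ 0 → T.rejectProb A₀ A₁ P ≤ α

end Risk

end AlgorithmComparison

end

open MeasureTheory Filter Topology
open scoped unitInterval NNReal ENNReal

noncomputable section

namespace AlgorithmComparison

section ProductMeasure

variable {ι Z : Type*} [Fintype ι] [MeasurableSpace Z]

lemma measure_pi_mono {μ ν : Measure Z} [SigmaFinite μ] [SigmaFinite ν] (h : μ ≤ ν) :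
    (Measure.pi fun _ : ι => μ) ≤ Measure.pi fun _ : ι => ν := by
  have key : (Measure.pi fun _ : ι => μ).toOuterMeasure ≤
      OuterMeasure.pi fun _ : ι => ν.toOuterMeasure := by
    rw [OuterMeasure.le_pi]
    intro s _
    change (Measure.pi fun _ : ι => μ) (Set.univ.pi s) ≤ _
    rw [Measure.pi_pi]
    exact Finset.prod_le_prod' fun i _ => h (s i)
  refine Measure.le_iff.2 fun s hs => ?_
  have e : (Measure.pi fun _ : ι => ν) s =
      (OuterMeasure.pi fun _ : ι => ν.toOuterMeasure) s := by
    rw [Measure.pi, toMeasure_apply _ _ hs]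
  rw [e]
  exact key s

lemma measure_pi_smul (μ : Measure Z) [SigmaFinite μ] (c : ℝ≥0) :
    (Measure.pi fun _ : ι => c • μ) = c ^ Fintype.card ι • Measure.pi fun _ : ι => μ := by
  refine Measure.pi_eq fun s _ => ?_
  rw [Measure.smul_apply, Measure.pi_pi]
  simp only [Measure.smul_apply, ENNReal.smul_def, smul_eq_mul, Finset.prod_mul_distrib,
    Finset.prod_const, Finset.card_univ, ENNReal.coe_pow]

end ProductMeasure

section Contamination

variable {Z : Type*} [MeasurableSpace Z]

/-- The mixture of `P` and of the point mass at `z`, with weights `s` and `t`. -/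
def contaminate (P : Measure Z) (s t : ℝ≥0) (z : Z) : Measure Z :=
  s • P + t • Measure.dirac z

instance (P : Measure Z) [IsFiniteMeasure P] (s t : ℝ≥0) (z : Z) :
    IsFiniteMeasure (contaminate P s t z) := by
  unfold contaminate; infer_instance

lemma isProbabilityMeasure_contaminate (P : Measure Z) [IsProbabilityMeasure P] {s t : ℝ≥0}
    (hst : s + t = 1) (z : Z) : IsProbabilityMeasure (contaminate P s t z) := by
  constructor
  simp only [contaminate, Measure.add_apply, Measure.smul_apply, measure_univ,
    ENNReal.smul_def, smul_eq_mul, mul_one]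
  exact_mod_cast hst

lemma smul_le_contaminate (P : Measure Z) (s t : ℝ≥0) (z : Z) : s • P ≤ contaminate P s t z :=
  Measure.le_add_right le_rfl

lemma restrict_contaminate (P : Measure Z) (s t : ℝ≥0) {z : Z} {S : Set Z}
    (hS : MeasurableSet S) (hz : z ∈ S) :
    (contaminate P s t z).restrict Sᶜ = s • P.restrict Sᶜ := by
  classical
  simp [contaminate, Measure.restrict_add, Measure.restrict_smul, restrict_dirac' hS.compl, hz]

lemma integral_contaminate (P : Measure Z) [IsFiniteMeasure P] (s t : ℝ≥0) (z : Z) {f : Z → ℝ}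
    (hf : StronglyMeasurable f) (hfP : Integrable f P) :
    ∫ x, f x ∂(contaminate P s t z) = s * ∫ x, f x ∂P + t * f z := by
  have h1 : Integrable f (s • P) := hfP.smul_measure_nnreal
  have h2 : Integrable f (t • Measure.dirac z) :=
    (integrable_dirac' hf (by simp)).smul_measure_nnreal
  rw [contaminate, integral_add_measure h1 h2, integral_smul_nnreal_measure,
    integral_smul_nnreal_measure, integral_dirac' _ _ hf]
  simp [NNReal.smul_def]

end Contamination

section Avoiding

variable {X Y : Type*}

/-- The data sets of size `m` which avoid `S`. -/
def avoiding (S : Set (X × Y)) (m : ℕ) : Set (DataTuple X Y m) := Set.univ.pi fun _ => Sᶜ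

lemma eventually_mem_avoiding {S : ℕ → Set (X × Y)}
    (hdisj : Pairwise (Function.onFun Disjoint S)) {m : ℕ} (D : DataTuple X Y m) :
    ∀ᶠ j in atTop, D ∈ avoiding (S j) m := by
  have h : ∀ i, ∀ᶠ j in atTop, D i ∉ S j := by
    intro i
    by_cases hi : ∃ j, D i ∈ S j
    · obtain ⟨j, hj⟩ := hi
      filter_upwards [eventually_gt_atTop j] with k hk hk'
      exact Set.disjoint_left.1 (hdisj hk.ne) hj hk'
    · exact Eventually.of_forall fun j hj => hi ⟨j, hj⟩
  filter_upwards [eventually_all.2 h] with j hj i _ using hj i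

end Avoiding

variable {X Y Yhat : Type*} [MeasurableSpace X] [MeasurableSpace Y] [MeasurableSpace Yhat]

lemma measurableSet_avoiding {S : Set (X × Y)} (hS : MeasurableSet S) (m : ℕ) :
    MeasurableSet (avoiding S m) :=
  MeasurableSet.univ_pi fun _ => hS.compl

open Classical in
/-- The algorithm which returns the model `g` on data sets meeting `S`, and otherwise runs `A`. -/
def Algorithm.patch (A : Algorithm X Y Yhat) {S : Set (X × Y)} (hS : MeasurableSet S)
    (g : Model X Yhat) : Algorithm X Y Yhat where
  run m D ξ := if D ∈ avoiding S m then A.run m D ξ else g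
  measurable_run m := by
    have hs : MeasurableSet {p : DataTuple X Y m × I × X | p.1 ∈ avoiding S m} :=
      measurable_fst (measurableSet_avoiding hS m)
    convert Measurable.ite hs (A.measurable_run m) (g.2.comp (measurable_snd.comp measurable_snd))
      using 2 with p
    · split_ifs <;> rfl
    · infer_instance

lemma Algorithm.patch_run_of_mem (A : Algorithm X Y Yhat) {S : Set (X × Y)}
    (hS : MeasurableSet S) (g : Model X Yhat) {m : ℕ} {D : DataTuple X Y m}
    (hD : D ∈ avoiding S m) (ξ : I) : (A.patch hS g).run m D ξ = A.run m D ξ :=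
  if_pos hD

lemma Algorithm.patch_run_of_notMem (A : Algorithm X Y Yhat) {S : Set (X × Y)}
    (hS : MeasurableSet S) (g : Model X Yhat) {m : ℕ} {D : DataTuple X Y m}
    (hD : D ∉ avoiding S m) (ξ : I) : (A.patch hS g).run m D ξ = g :=
  if_neg hD

section Coupling

variable {N : ℕ}

/-- If no data set generated before the stopping time meets `S`, then changing the algorithms on
data sets meeting `S` does not change the output. -/
lemma Procedure.output_patch_eq (T : Procedure X Y Yhat N) (A₀ A₁ : Algorithm X Y Yhat)
    {S : Set (X × Y)} (hS : MeasurableSet S) (g₀ g₁ : Model X Yhat) (ω : Outcome X Y N) {R : ℕ}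
    (hR : T.StopsAt A₀ A₁ ω.1 ω.2.1 R)
    (hav : ∀ r < R, (T.query r ω.1 (T.history A₀ A₁ ω.1 ω.2.1 r) (ω.2.1 r)).1.2 ∈
      avoiding S _) :
    T.output (A₀.patch hS g₀) (A₁.patch hS g₁) ω = T.output A₀ A₁ ω := by
  classical
  have hist : ∀ r ≤ R, T.history (A₀.patch hS g₀) (A₁.patch hS g₁) ω.1 ω.2.1 r =
      T.history A₀ A₁ ω.1 ω.2.1 r := by
    intro r
    induction r with
    | zero => intro _; rfl
    | succ r ih =>
      intro hr
      simp only [Procedure.history]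
      rw [ih (by omega)]
      congr 1
      simp only [Procedure.nextRound, Algorithm.patch_run_of_mem _ hS _ (hav r (by omega))]
  have stopsAt_iff : ∀ r ≤ R, T.StopsAt (A₀.patch hS g₀) (A₁.patch hS g₁) ω.1 ω.2.1 r ↔
      T.StopsAt A₀ A₁ ω.1 ω.2.1 r := by
    intro r hr
    simp only [Procedure.StopsAt, hist r hr]
  have h : ∃ r, T.StopsAt A₀ A₁ ω.1 ω.2.1 r := ⟨R, hR⟩
  have h' : ∃ r, T.StopsAt (A₀.patch hS g₀) (A₁.patch hS g₁) ω.1 ω.2.1 r :=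
    ⟨R, (stopsAt_iff R le_rfl).2 hR⟩
  have hle : Nat.find h ≤ R := Nat.find_min' h hR
  have hfind : Nat.find h' = Nat.find h := by
    rw [Nat.find_eq_iff]
    exact ⟨(stopsAt_iff _ hle).2 (Nat.find_spec h), fun k hk hk' =>
      Nat.find_min h hk ((stopsAt_iff k (by omega)).1 hk')⟩
  simp only [Procedure.output]
  rw [dif_pos h', dif_pos h, hfind, hist _ hle]

lemma Procedure.eventually_output_patch_eq (T : Procedure X Y Yhat N)
    (A₀ A₁ : Algorithm X Y Yhat) {S : ℕ → Set (X × Y)} (hS : ∀ j, MeasurableSet (S j))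
    (hdisj : Pairwise (Function.onFun Disjoint S)) (g₀ g₁ : Model X Yhat) (ω : Outcome X Y N)
    (h : ∃ r, T.StopsAt A₀ A₁ ω.1 ω.2.1 r) :
    ∀ᶠ j in atTop,
      T.output (A₀.patch (hS j) g₀) (A₁.patch (hS j) g₁) ω = T.output A₀ A₁ ω := by
  obtain ⟨R, hR⟩ := h
  filter_upwards [(Finset.range R).eventually_all.2 fun r _ => eventually_mem_avoiding hdisj
    (T.query r ω.1 (T.history A₀ A₁ ω.1 ω.2.1 r) (ω.2.1 r)).1.2] with j hj
  exact T.output_patch_eq A₀ A₁ (hS j) g₀ g₁ ω hR fun r hr => hj r (Finset.mem_range.2 hr)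

instance (P : Measure (X × Y)) [IsProbabilityMeasure P] :
    IsProbabilityMeasure (outcomeLaw P N) := by
  unfold outcomeLaw; infer_instance

lemma BlackBoxTest.measurableSet_reject (T : BlackBoxTest X Y Yhat N)
    (A₀ A₁ : Algorithm X Y Yhat) : MeasurableSet {ω | T.output A₀ A₁ ω = true} :=
  T.measurable_output A₀ A₁ (measurableSet_singleton true)

lemma BlackBoxTest.tendsto_rejectProb_patch (T : BlackBoxTest X Y Yhat N)
    (A₀ A₁ : Algorithm X Y Yhat) {S : ℕ → Set (X × Y)} (hS : ∀ j, MeasurableSet (S j))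
    (hdisj : Pairwise (Function.onFun Disjoint S)) (g₀ g₁ : Model X Yhat)
    (P : Measure (X × Y)) [IsProbabilityMeasure P] :
    Tendsto (fun j => T.rejectProb (A₀.patch (hS j) g₀) (A₁.patch (hS j) g₁) P) atTop
      (𝓝 (T.rejectProb A₀ A₁ P)) := by
  refine (ENNReal.tendsto_toReal (measure_ne_top _ _)).comp ?_
  refine tendsto_measure_of_ae_tendsto_indicator_of_isFiniteMeasure atTop
    (T.measurableSet_reject A₀ A₁) (fun j => T.measurableSet_reject _ _) ?_
  filter_upwards [T.terminates A₀ A₁ P inferInstance] with ω hω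
  filter_upwards [T.eventually_output_patch_eq A₀ A₁ hS hdisj g₀ g₁ ω hω] with j hj
  simp [hj]

lemma BlackBoxTest.pow_mul_rejectProb_le (T : BlackBoxTest X Y Yhat N)
    (A₀ A₁ : Algorithm X Y Yhat) (P : Measure (X × Y)) [IsProbabilityMeasure P] {s t : ℝ≥0}
    (hst : s + t = 1) (z : X × Y) :
    (s : ℝ) ^ N * T.rejectProb A₀ A₁ P ≤ T.rejectProb A₀ A₁ (contaminate P s t z) := by
  have := isProbabilityMeasure_contaminate P hst z
  have hle : s ^ N • outcomeLaw P N ≤ outcomeLaw (contaminate P s t z) N := by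
    have h := measure_pi_mono (ι := Fin N) (smul_le_contaminate P s t z)
    rw [measure_pi_smul, Fintype.card_fin] at h
    unfold outcomeLaw
    rw [← Measure.prod_smul_left]
    exact Measure.prod_mono h le_rfl
  have := ENNReal.toReal_mono (measure_ne_top _ _) (hle {ω | T.output A₀ A₁ ω = true})
  simpa [ENNReal.smul_def, BlackBoxTest.rejectProb, Measure.real] using this

end Coupling

section Delta

variable {ψ : Yhat → Yhat → Y → ℝ} {B : ℝ}

lemma abs_integral_le_of_abs_le {Ω : Type*} [MeasurableSpace Ω] (μ : Measure Ω)
    [IsProbabilityMeasure μ] {f : Ω → ℝ} {C : ℝ} (hf : ∀ x, |f x| ≤ C) : |∫ x, f x ∂μ| ≤ C := by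
  simpa using norm_integral_le_of_norm_le_const (μ := μ) (f := f) (C := C)
    (Eventually.of_forall fun x => hf x)

lemma integrable_of_abs_le {Ω : Type*} [MeasurableSpace Ω] {μ : Measure Ω}
    [IsFiniteMeasure μ] {f : Ω → ℝ} (hm : Measurable f) {C : ℝ} (hf : ∀ x, |f x| ≤ C) :
    Integrable f μ :=
  Integrable.of_bound hm.aestronglyMeasurable C (Eventually.of_forall fun x => hf x)

lemma integral_const_add_mul {Ω : Type*} [MeasurableSpace Ω] (μ : Measure Ω)
    [IsProbabilityMeasure μ] {f : Ω → ℝ} (hf : Integrable f μ) (a b c : ℝ) :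
    ∫ x, (a + b * (c + f x)) ∂μ = a + b * (c + ∫ x, f x ∂μ) := by
  have h : Integrable (fun x => c + f x) μ := (integrable_const c).add hf
  rw [integral_add (integrable_const a) (h.const_mul b), integral_const_mul,
    integral_add (integrable_const c) hf]
  simp

lemma measurable_loss (hψ : Measurable fun p : Yhat × Yhat × Y => ψ p.1 p.2.1 p.2.2)
    (f₀ f₁ : Model X Yhat) : Measurable fun z : X × Y => ψ (f₀.1 z.1) (f₁.1 z.1) z.2 :=
  hψ.comp ((f₀.2.comp measurable_fst).prodMk ((f₁.2.comp measurable_fst).prodMk measurable_snd))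

lemma modelDelta_swap (hanti : ∀ u v y, ψ u v y = -ψ v u y) (P : Measure (X × Y))
    (f₀ f₁ : Model X Yhat) : modelDelta ψ P f₀ f₁ = -modelDelta ψ P f₁ f₀ := by
  unfold modelDelta
  rw [← integral_neg]
  exact integral_congr_ae (Eventually.of_forall fun z => hanti _ _ _)

lemma measurable_modelDelta_run (hψ : Measurable fun p : Yhat × Yhat × Y => ψ p.1 p.2.1 p.2.2)
    (P : Measure (X × Y)) [SFinite P] (n : ℕ) (A₀ A₁ : Algorithm X Y Yhat) :
    Measurable fun ω : DataTuple X Y n × I =>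
      modelDelta ψ P (A₀.run n ω.1 ω.2) (A₁.run n ω.1 ω.2) := by
  have hrun (A : Algorithm X Y Yhat) : Measurable fun q : (DataTuple X Y n × I) × (X × Y) =>
      (A.run n q.1.1 q.1.2).1 q.2.1 :=
    (A.measurable_run n).comp (by fun_prop : Measurable
      fun q : (DataTuple X Y n × I) × (X × Y) => (q.1.1, q.1.2, q.2.1))
  have h : Measurable fun q : (DataTuple X Y n × I) × (X × Y) =>
      ψ ((A₀.run n q.1.1 q.1.2).1 q.2.1) ((A₁.run n q.1.1 q.1.2).1 q.2.1) q.2.2 :=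
    hψ.comp ((hrun A₀).prodMk ((hrun A₁).prodMk (by fun_prop)))
  exact (h.stronglyMeasurable.integral_prod_right' (ν := P)).measurable

lemma modelDelta_contaminate_le (hψ : Measurable fun p : Yhat × Yhat × Y => ψ p.1 p.2.1 p.2.2)
    (hB : ∀ u v y, |ψ u v y| ≤ B) (P : Measure (X × Y)) [IsProbabilityMeasure P] (s t : ℝ≥0)
    (z : X × Y) (f₀ f₁ : Model X Yhat) :
    modelDelta ψ (contaminate P s t z) f₀ f₁ ≤ s * modelDelta ψ P f₀ f₁ + t * B := by
  have hm := measurable_loss (X := X) hψ f₀ f₁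
  unfold modelDelta
  rw [integral_contaminate P s t z hm.stronglyMeasurable
    (integrable_of_abs_le hm fun _ => hB _ _ _)]
  gcongr
  exact (abs_le.1 (hB _ _ _)).2

/-- Under contamination by a point of `S`, integrals over the data sets avoiding `S` are rescaled
integrals under the original distribution. -/
lemma integral_indicator_avoiding_contaminate (P : Measure (X × Y)) [IsProbabilityMeasure P]
    (s t : ℝ≥0) {z : X × Y} {S : Set (X × Y)} (hS : MeasurableSet S) (hz : z ∈ S) (n : ℕ)
    (f : DataTuple X Y n × I → ℝ) :
    ∫ ω, (avoiding S n ×ˢ Set.univ).indicator f ω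
      ∂((Measure.pi fun _ : Fin n => contaminate P s t z).prod (volume : Measure I)) =
    s ^ n * ∫ ω, (avoiding S n ×ˢ Set.univ).indicator f ω
      ∂((Measure.pi fun _ : Fin n => P).prod (volume : Measure I)) := by
  have hm : MeasurableSet (avoiding S n ×ˢ (Set.univ : Set I)) :=
    (measurableSet_avoiding hS n).prod MeasurableSet.univ
  rw [integral_indicator hm, integral_indicator hm, ← Measure.prod_restrict,
    ← Measure.prod_restrict]
  have h : (Measure.pi fun _ : Fin n => contaminate P s t z).restrict (avoiding S n) =
      s ^ n • (Measure.pi fun _ : Fin n => P).restrict (avoiding S n) := by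
    simp only [avoiding, Measure.restrict_pi_pi, restrict_contaminate P s t hS hz]
    rw [measure_pi_smul, Fintype.card_fin]
  rw [h, Measure.prod_smul_left, integral_smul_nnreal_measure]
  simp [NNReal.smul_def]

lemma algDelta_patch_contaminate_le
    (hψ : Measurable fun p : Yhat × Yhat × Y => ψ p.1 p.2.1 p.2.2)
    (hB : ∀ u v y, |ψ u v y| ≤ B) (P : Measure (X × Y)) [IsProbabilityMeasure P] {s t : ℝ≥0}
    (hst : s + t = 1) {z : X × Y} {S : Set (X × Y)} (hS : MeasurableSet S) (hz : z ∈ S) (n : ℕ)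
    (A₀ A₁ : Algorithm X Y Yhat) {g₀ g₁ : Model X Yhat} {M : ℝ}
    (hg : modelDelta ψ P g₀ g₁ ≤ -M) :
    algDelta ψ (contaminate P s t z) n (A₀.patch hS g₀) (A₁.patch hS g₁) ≤
      t * B + s * (-M + s ^ n * ∫ ω, (avoiding S n ×ˢ Set.univ).indicator
        (fun ω => modelDelta ψ P (A₀.run n ω.1 ω.2) (A₁.run n ω.1 ω.2) + M) ω
        ∂((Measure.pi fun _ : Fin n => P).prod (volume : Measure I))) := by
  have := isProbabilityMeasure_contaminate P hst z
  have hbound (Q : Measure (X × Y)) [IsProbabilityMeasure Q] (f₀ f₁ : Model X Yhat) :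
      |modelDelta ψ Q f₀ f₁| ≤ B := abs_integral_le_of_abs_le Q fun _ => hB _ _ _
  have hm : MeasurableSet (avoiding S n ×ˢ (Set.univ : Set I)) :=
    (measurableSet_avoiding hS n).prod MeasurableSet.univ
  rw [← integral_indicator_avoiding_contaminate P s t hS hz]
  set μ := (Measure.pi fun _ : Fin n => contaminate P s t z).prod (volume : Measure I)
  have hint : Integrable ((avoiding S n ×ˢ (Set.univ : Set I)).indicator
      fun ω => modelDelta ψ P (A₀.run n ω.1 ω.2) (A₁.run n ω.1 ω.2) + M) μ :=
    ((integrable_of_abs_le (measurable_modelDelta_run hψ P n A₀ A₁)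
      fun _ => hbound P _ _).add (integrable_const M)).indicator hm
  rw [← integral_const_add_mul μ hint]
  refine integral_mono (integrable_of_abs_le (measurable_modelDelta_run hψ _ n _ _)
    fun _ => hbound _ _ _)
    ((integrable_const _).add (((integrable_const _).add hint).const_mul _)) fun ω => ?_
  refine (modelDelta_contaminate_le hψ hB P s t z _ _).trans ?_
  rw [add_comm]
  gcongr
  by_cases hω : ω.1 ∈ avoiding S n
  · rw [Set.indicator_of_mem (by simpa using hω), Algorithm.patch_run_of_mem _ _ _ hω,
      Algorithm.patch_run_of_mem _ _ _ hω]
    linarith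
  · rw [Set.indicator_of_notMem (by simpa using hω), Algorithm.patch_run_of_notMem _ _ _ hω,
      Algorithm.patch_run_of_notMem _ _ _ hω]
    linarith

lemma tendsto_integral_indicator_avoiding (P : Measure (X × Y)) [IsProbabilityMeasure P]
    {S : ℕ → Set (X × Y)} (hS : ∀ j, MeasurableSet (S j))
    (hdisj : Pairwise (Function.onFun Disjoint S)) (n : ℕ) {f : DataTuple X Y n × I → ℝ}
    (hf : Integrable f ((Measure.pi fun _ : Fin n => P).prod (volume : Measure I))) :
    Tendsto (fun j => ∫ ω, (avoiding (S j) n ×ˢ Set.univ).indicator f ω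
      ∂((Measure.pi fun _ : Fin n => P).prod (volume : Measure I))) atTop
      (𝓝 (∫ ω, f ω ∂((Measure.pi fun _ : Fin n => P).prod (volume : Measure I)))) := by
  refine tendsto_integral_of_dominated_convergence (fun ω => ‖f ω‖) (fun j => ?_) hf.norm
    (fun j => Eventually.of_forall fun ω => norm_indicator_le_norm_self _ _)
    (Eventually.of_forall fun ω => ?_)
  · exact hf.aestronglyMeasurable.indicator
      ((measurableSet_avoiding (hS j) n).prod MeasurableSet.univ)
  · refine tendsto_const_nhds.congr' ?_
    filter_upwards [eventually_mem_avoiding hdisj ω.1] with j hj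
    rw [Set.indicator_of_mem (by simpa using hj)]

end Delta

lemma exists_disjoint_measurableSet_seq [MeasurableSingletonClass X] [MeasurableSingletonClass Y]
    [Nonempty X] [Nonempty Y] (hXY : Infinite X ∨ Infinite Y) :
    ∃ S : ℕ → Set (X × Y), (∀ j, MeasurableSet (S j)) ∧
      Pairwise (Function.onFun Disjoint S) ∧ ∀ j, (S j).Nonempty := by
  rcases hXY with h | h
  · let x := Infinite.natEmbedding X
    refine ⟨fun j => Prod.fst ⁻¹' {x j}, fun j => measurable_fst (measurableSet_singleton _),
      fun i j hij => ?_, fun j => ⟨(x j, Classical.arbitrary Y), rfl⟩⟩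
    exact Disjoint.preimage _ (by simpa using hij)
  · let y := Infinite.natEmbedding Y
    refine ⟨fun j => Prod.snd ⁻¹' {y j}, fun j => measurable_snd (measurableSet_singleton _),
      fun i j hij => ?_, fun j => ⟨(Classical.arbitrary X, y j), rfl⟩⟩
    exact Disjoint.preimage _ (by simpa using hij)

/-- The power bound for a fixed weight `s` of the original distribution in the contaminated
distribution. -/
lemma BlackBoxTest.IsValid.pow_mul_rejectProb_le
    [MeasurableSingletonClass X] [MeasurableSingletonClass Y]
    (hXY : Infinite X ∨ Infinite Y) {ψ : Yhat → Yhat → Y → ℝ} {B : ℝ}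
    (hψ : Measurable fun p : Yhat × Yhat × Y => ψ p.1 p.2.1 p.2.2)
    (hanti : ∀ u v y, ψ u v y = -ψ v u y) (hB : ∀ u v y, |ψ u v y| ≤ B)
    {α : ℝ} {n N : ℕ} {T : BlackBoxTest X Y Yhat N} (hT : T.IsValid ψ n α)
    (A₀ A₁ : Algorithm X Y Yhat) (P : Measure (X × Y)) [IsProbabilityMeasure P]
    {s : ℝ} (hs0 : 0 < s) (hs1 : s < 1)
    (hs : (1 - s) * B + s * (s ^ n * (algDelta ψ P n A₀ A₁ + deltaMax ψ P) - deltaMax ψ P) < 0) :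
    s ^ N * T.rejectProb A₀ A₁ P ≤ α := by
  obtain ⟨⟨x₀, y₀⟩⟩ := nonempty_of_isProbabilityMeasure P
  have : Nonempty X := ⟨x₀⟩
  have : Nonempty Y := ⟨y₀⟩
  have : Nonempty (Model X Yhat) := ⟨A₀.run 0 Fin.elim0 0⟩
  obtain ⟨S, hS, hdisj, hne⟩ := exists_disjoint_measurableSet_seq (X := X) (Y := Y) hXY
  choose z hz using hne
  lift s to ℝ≥0 using hs0.le
  obtain ⟨t, hst⟩ : ∃ t : ℝ≥0, s + t = 1 :=
    ⟨1 - s, add_tsub_cancel_of_le (by exact_mod_cast hs1.le)⟩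
  have ht : (t : ℝ) = 1 - s := by
    have : (s : ℝ) + t = 1 := by exact_mod_cast hst
    linarith
  rw [← ht] at hs
  set Δ := algDelta ψ P n A₀ A₁ with hΔ
  obtain ⟨M, hM, hMs⟩ : ∃ M < deltaMax ψ P, t * B + s * (-M + s ^ n * (Δ + M)) < 0 := by
    have hc : Continuous fun M : ℝ => (t : ℝ) * B + s * (-M + s ^ n * (Δ + M)) := by fun_prop
    have hev := (hc.tendsto (deltaMax ψ P)).eventually_lt_const
      (show (t : ℝ) * B + s * (-deltaMax ψ P + s ^ n * (Δ + deltaMax ψ P)) < 0 by linarith)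
    obtain ⟨M, h1, h2⟩ :=
      ((hev.filter_mono (nhdsWithin_le_nhds (s := Set.Iio (deltaMax ψ P)))).and
        self_mem_nhdsWithin).exists
    exact ⟨M, h2, h1⟩
  obtain ⟨⟨g₁, g₀⟩, hg⟩ := exists_lt_of_lt_ciSup hM
  have hg' : modelDelta ψ P g₀ g₁ ≤ -M := by
    rw [modelDelta_swap hanti]
    exact neg_le_neg hg.le
  have hint : Integrable (fun ω : DataTuple X Y n × I =>
      modelDelta ψ P (A₀.run n ω.1 ω.2) (A₁.run n ω.1 ω.2))
      ((Measure.pi fun _ : Fin n => P).prod (volume : Measure I)) :=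
    integrable_of_abs_le (measurable_modelDelta_run hψ P n A₀ A₁)
      fun _ => abs_integral_le_of_abs_le P fun _ => hB _ _ _
  have hlim := tendsto_integral_indicator_avoiding P hS hdisj n (hint.add (integrable_const M))
  have hval : ∫ ω : DataTuple X Y n × I,
      (modelDelta ψ P (A₀.run n ω.1 ω.2) (A₁.run n ω.1 ω.2) + M)
      ∂((Measure.pi fun _ : Fin n => P).prod (volume : Measure I)) = Δ + M := by
    rw [integral_add hint (integrable_const M), hΔ]
    simp [algDelta]
  simp only [Pi.add_apply] at hlim
  rw [hval] at hlim
  have hev := (((hlim.const_mul ((s : ℝ) ^ n)).const_add (-M)).const_mul (s : ℝ)).const_add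
    ((t : ℝ) * B) |>.eventually_lt_const hMs
  refine le_of_tendsto
    ((T.tendsto_rejectProb_patch A₀ A₁ hS hdisj g₀ g₁ P).const_mul ((s : ℝ) ^ N)) ?_
  filter_upwards [hev] with j hj
  refine (T.pow_mul_rejectProb_le _ _ P hst (z j)).trans ?_
  exact hT _ _ _ (isProbabilityMeasure_contaminate P hst (z j))
    ((algDelta_patch_contaminate_le hψ hB P hst (hS j) (hz j) n A₀ A₁ hg').trans hj.le)

/-- The power bound with the optimal weight perturbed: any `q` slightly above the critical ratio
is admissible, the weight of the original distribution being `q ^ (-1 / n)`. -/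
lemma BlackBoxTest.IsValid.rejectProb_le_mul_rpow
    [MeasurableSingletonClass X] [MeasurableSingletonClass Y]
    (hXY : Infinite X ∨ Infinite Y) {ψ : Yhat → Yhat → Y → ℝ} {B : ℝ}
    (hψ : Measurable fun p : Yhat × Yhat × Y => ψ p.1 p.2.1 p.2.2)
    (hanti : ∀ u v y, ψ u v y = -ψ v u y) (hB : ∀ u v y, |ψ u v y| ≤ B) (hB0 : 0 ≤ B)
    {α : ℝ} (hα : 0 < α) {n N : ℕ} (hn : 1 ≤ n) (hN : 1 ≤ N) {T : BlackBoxTest X Y Yhat N}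
    (hT : T.IsValid ψ n α) (A₀ A₁ : Algorithm X Y Yhat) (P : Measure (X × Y))
    [IsProbabilityMeasure P] {q : ℝ} (hq1 : 1 < q) (hqα : α * q ^ ((N : ℝ) / n) < 1)
    (hq : algDelta ψ P n A₀ A₁ + deltaMax ψ P < q * (deltaMax ψ P - B * (α⁻¹ - 1) / N)) :
    T.rejectProb A₀ A₁ P ≤ α * q ^ ((N : ℝ) / n) := by
  have hn' : (0 : ℝ) < n := by exact_mod_cast hn
  have hN' : (0 : ℝ) < N := by exact_mod_cast hN
  have hq0 : 0 < q := by linarith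
  set u : ℝ := q ^ ((1 : ℝ) / n) with hu
  have hu1 : 1 < u := Real.one_lt_rpow hq1 (by positivity)
  have hu0 : 0 < u := by linarith
  have hun : u ^ n = q := by
    rw [hu, ← Real.rpow_natCast, ← Real.rpow_mul hq0.le, one_div_mul_cancel hn'.ne',
      Real.rpow_one]
  have huN : u ^ N = q ^ ((N : ℝ) / n) := by
    rw [hu, ← Real.rpow_natCast, ← Real.rpow_mul hq0.le, one_div_mul_eq_div]
  have hbern : (u - 1) * N ≤ α⁻¹ - 1 := by
    have h1 := one_add_mul_le_pow (show (-2 : ℝ) ≤ u - 1 by linarith) N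
    have h2 : u ^ N ≤ α⁻¹ := by
      rw [← one_div, le_div_iff₀ hα, huN, mul_comm]
      exact hqα.le
    rw [add_sub_cancel] at h1
    linarith
  have hK : (u - 1) * B ≤ B * (α⁻¹ - 1) / N := by
    rw [le_div_iff₀ hN']
    nlinarith [mul_le_mul_of_nonneg_left hbern hB0]
  have hdiv : q⁻¹ * (algDelta ψ P n A₀ A₁ + deltaMax ψ P) <
      deltaMax ψ P - B * (α⁻¹ - 1) / N := by
    rwa [inv_mul_lt_iff₀ hq0]
  have key := hT.pow_mul_rejectProb_le hXY hψ hanti hB A₀ A₁ P (s := u⁻¹) (by positivity)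
    (inv_lt_one_of_one_lt₀ hu1) (by
      rw [inv_pow, hun]
      have h : (1 - u⁻¹) * B + u⁻¹ * (q⁻¹ * (algDelta ψ P n A₀ A₁ + deltaMax ψ P) -
          deltaMax ψ P) = u⁻¹ * ((u - 1) * B + (q⁻¹ * (algDelta ψ P n A₀ A₁ + deltaMax ψ P) -
          deltaMax ψ P)) := by
        field_simp
      rw [h]
      exact mul_neg_of_pos_of_neg (by positivity) (by linarith))
  rwa [inv_pow, huN, inv_mul_le_iff₀ (by positivity), mul_comm] at key

end AlgorithmComparison

end

theorem mainTheorem4 {X Y Yhat : Type*}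
    [MeasurableSpace X] [MeasurableSpace Y] [MeasurableSpace Yhat]
    [MeasurableSingletonClass X] [MeasurableSingletonClass Y]
    (hXY : Infinite X ∨ Infinite Y)
    (ψ : Yhat → Yhat → Y → ℝ) (B : ℝ)
    (hψ_meas : Measurable fun p : Yhat × Yhat × Y => ψ p.1 p.2.1 p.2.2)
    (hψ_antisymm : ∀ u v y, ψ u v y = -ψ v u y)
    (hψ_bdd : ∀ u v y, ψ u v y ∈ Set.Icc (-B) B)
    (α : ℝ) (hα : α ∈ Set.Ioo (0 : ℝ) 1) (n N : ℕ) (hn : 1 ≤ n) (hN : 1 ≤ N)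
    (T : AlgorithmComparison.BlackBoxTest X Y Yhat N) (hT : T.IsValid ψ n α)
    (A₀ A₁ : AlgorithmComparison.Algorithm X Y Yhat)
    (P : MeasureTheory.Measure (X × Y)) [MeasureTheory.IsProbabilityMeasure P]
    (hΔ : 0 < AlgorithmComparison.algDelta ψ P n A₀ A₁)
    (hmax : B * (α⁻¹ - 1) / N < AlgorithmComparison.deltaMax ψ P) :
    T.rejectProb A₀ A₁ P ≤
      min (α * (1 + (AlgorithmComparison.algDelta ψ P n A₀ A₁ + B * (α⁻¹ - 1) / N) /
        (AlgorithmComparison.deltaMax ψ P - B * (α⁻¹ - 1) / N)) ^ ((N : ℝ) / (n : ℝ))) 1 := by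
  have hB : ∀ u v y, |ψ u v y| ≤ B := fun u v y => abs_le.2 (hψ_bdd u v y)
  obtain ⟨⟨x₀, y₀⟩⟩ := MeasureTheory.nonempty_of_isProbabilityMeasure P
  have hB0 : 0 ≤ B :=
    (abs_nonneg _).trans (hB ((A₀.run 0 Fin.elim0 0).1 x₀) ((A₀.run 0 Fin.elim0 0).1 x₀) y₀)
  have hK : 0 ≤ B * (α⁻¹ - 1) / N :=
    div_nonneg (mul_nonneg hB0 (sub_nonneg.2 ((one_le_inv₀ hα.1).2 hα.2.le))) N.cast_nonneg
  have hprob : T.rejectProb A₀ A₁ P ≤ 1 := MeasureTheory.measureReal_le_one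
  refine le_min ?_ hprob
  set Δ := AlgorithmComparison.algDelta ψ P n A₀ A₁
  set L := AlgorithmComparison.deltaMax ψ P
  set K := B * (α⁻¹ - 1) / N
  set R := 1 + (Δ + K) / (L - K) with hR
  have hLK : 0 < L - K := sub_pos.2 hmax
  have hR1 : 1 < R := lt_add_of_pos_right _ (div_pos (by linarith) hLK)
  have hRmul : R * (L - K) = Δ + L := by
    rw [hR, add_mul, div_mul_cancel₀ _ hLK.ne']
    ring
  rcases le_or_gt 1 (α * R ^ ((N : ℝ) / (n : ℝ))) with h1 | h1
  · exact hprob.trans h1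
  have hcont : Filter.Tendsto (fun q : ℝ => α * q ^ ((N : ℝ) / (n : ℝ)))
      (nhdsWithin R (Set.Ioi R)) (nhds (α * R ^ ((N : ℝ) / (n : ℝ)))) :=
    ((Real.continuousAt_rpow_const R _ (Or.inl (by linarith))).const_mul α).mono_left
      nhdsWithin_le_nhds
  refine ge_of_tendsto hcont ?_
  filter_upwards [hcont.eventually_lt_const h1, self_mem_nhdsWithin] with q hqα hq
  refine hT.rejectProb_le_mul_rpow hXY hψ_meas hψ_antisymm hB hB0 hα.1 hn hN A₀ A₁ P
    (hR1.trans hq) hqα ?_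
  rw [← hRmul]
  exact mul_lt_mul_of_pos_right hq hLK
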